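/- Let $A,B\in\mathbb C^{n\times n}$ be such that the pencil $A-\lambda B$ is singular, i.e. $\det(A-\lambda B)\equiv 0$, with normal rank $\max_{\zeta\in\mathbb C}\operatorname{rank}(A-\zeta B)=n-k$. Let $n_1,\dots,n_k$ be its left minimal indices and $m_1,\dots,m_k$ its right minimal indices; that is, for some nonsingular $P,Q$ the pencil $P(A-\lambda B)Q$ is in Kronecker canonical form, whose singular blocks are $L_{m_1}(\lambda),\dots,L_{m_k}(\lambda),L_{n_1}(\lambda)^\top,\dots,L_{n_k}(\lambda)^\top$, where $L_j(\lambda)=[0\ \ I_j]-\lambda[I_j\ \ 0]$ is of size $j\times(j+1)$. Put $M=m_1+\cdots+m_k$ and $N=n_1+\cdots+n_k$. Call $\lambda_0\in\mathbb C$ an eigenvalue of the pencil if $\operatorname{rank}(A-\lambda_0B)<n-k$, and let $\gamma_1,\dots,\gamma_k\in\mathbb C$ be given values (not necessarily distinct), none of which is an eigenvalue of $A-\lambda B$. Then for generic $U,V\in\mathbb C^{n\times k}$ of full column rank the following three statements hold simultaneously. (Generic means: there is a set $\Omega\subseteq\mathbb C^{2nk}$ whose complement is contained in a proper algebraic set,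 that is, in a set of common zeros of finitely many polynomials which is not all of $\mathbb C^{2nk}$, such that the statements hold for all $U,V$ of full column rank for which the vector of the entries of $U$ and $V^*$ lies in $\Omega$.) 1. Among the complex numbers that are not eigenvalues of $A-\lambda B$ there are exactly $M$ values $\alpha$ for which there is a vector $z\neq0$ with $(A-\alpha B)z=0$ and $V^*z=0$. These pairwise distinct values $\alpha_1,\dots,\alpha_M$ are all different from $\gamma_1,\dots,\gamma_k$. 2. Among the complex numbers that are not eigenvalues of $A-\lambda B$ there are exactly $N$ values $\beta$ for which there is a vector $w\neq0$ with $w^*(A-\beta B)=0$ and $w^*U=0$. These pairwise distinct values $\beta_1,\dots,\beta_N$ are all different from $\gamma_1,\dots,\gamma_k$ and from $\alpha_1,\dots,\alpha_M$. 3. For all linearly independent $t_1,\dots,t_k\in\mathbb C^k$ there are nonzero vectors $s_1,\dots,s_k\in\mathbb C^n$ with $(A-\gamma_iB)s_i=0$ and $V^*s_i=t_i$ for $i=1,\dots,k$. -/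

import Mathlib

open Matrix

namespace MatrixPencil

noncomputable section

/-- The normal rank of `A - lam B`: the maximum of `rank (A - z B)` over all complex `z`.
The ranks are bounded by the number of columns, so the supremum is attained. -/
def nrank {n m : ℕ} (A B : Matrix (Fin n) (Fin m) ℂ) : ℕ :=
  ⨆ z : ℂ, (A - z • B).rank

/-- A square pencil is singular if its determinant vanishes identically. -/
def IsSingular {n : ℕ} (A B : Matrix (Fin n) (Fin n) ℂ) : Prop :=
  ∀ z : ℂ, (A - z • B).det = 0

/-- `mu` is a (finite) eigenvalue of the pencil `A - lam B`: the rank drops below the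
normal rank at `mu`. -/
def IsEigenvalue {n m : ℕ} (A B : Matrix (Fin n) (Fin m) ℂ) (mu : ℂ) : Prop :=
  (A - mu • B).rank < nrank A B

/-! ### Kronecker canonical form -/

/-- The `d × d` Jordan block with eigenvalue `mu`. -/
def jordanBlock (d : ℕ) (mu : ℂ) : Matrix (Fin d) (Fin d) ℂ :=
  Matrix.of fun a b => if a = b then mu else if a.val + 1 = b.val then 1 else 0

/-- The constant coefficient `[0 I_j]` of `L_j(lam) = [0 I_j] - lam [I_j 0]`. -/
def LA (j : ℕ) : Matrix (Fin j) (Fin (j + 1)) ℂ :=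
  Matrix.of fun a b => if b = a.succ then 1 else 0

/-- The coefficient `[I_j 0]` of `-lam` in `L_j(lam) = [0 I_j] - lam [I_j 0]`. -/
def LB (j : ℕ) : Matrix (Fin j) (Fin (j + 1)) ℂ :=
  Matrix.of fun a b => if b = a.castSucc then 1 else 0

/-- The discrete data of a Kronecker canonical form: Jordan blocks of sizes `finSize b` with
eigenvalues `finEig b` for the finite eigenvalues, nilpotent Jordan blocks of sizes `infSize b`
for the eigenvalue infinity, `k` right minimal indices and `l` left minimal indices. -/
structure KCFData (k l : ℕ) where
  numFin : ℕ
  finSize : Fin numFin → ℕ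
  finEig : Fin numFin → ℂ
  numInf : ℕ
  infSize : Fin numInf → ℕ
  rightIdx : Fin k → ℕ
  leftIdx : Fin l → ℕ

namespace KCFData

variable {k l : ℕ}

/-- Indices of the regular part. -/
abbrev RegIdx (D : KCFData k l) : Type :=
  ((b : Fin D.numFin) × Fin (D.finSize b)) ⊕ ((b : Fin D.numInf) × Fin (D.infSize b))

/-- Row indices of the canonical form: `L_j` has `j` rows, `L_jᵀ` has `j + 1` rows. -/
abbrev RowIdx (D : KCFData k l) : Type :=
  D.RegIdx ⊕ (((i : Fin k) × Fin (D.rightIdx i)) ⊕ ((i : Fin l) × Fin (D.leftIdx i + 1)))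

/-- Column indices of the canonical form: `L_j` has `j + 1` columns, `L_jᵀ` has `j` columns. -/
abbrev ColIdx (D : KCFData k l) : Type :=
  D.RegIdx ⊕ (((i : Fin k) × Fin (D.rightIdx i + 1)) ⊕ ((i : Fin l) × Fin (D.leftIdx i)))

/-- The constant coefficient of the canonical form: `diag(J, I, [0 I], [0 I]ᵀ)`. -/
def matA (D : KCFData k l) : Matrix D.RowIdx D.ColIdx ℂ :=
  fromBlocks
    (fromBlocks (blockDiagonal' fun b => jordanBlock (D.finSize b) (D.finEig b)) 0 0 1) 0 0
    (fromBlocks (blockDiagonal' fun i => LA (D.rightIdx i)) 0 0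
      (blockDiagonal' fun i => (LA (D.leftIdx i))ᵀ))

/-- The coefficient of `-lam` of the canonical form: `diag(I, N, [I 0], [I 0]ᵀ)`. -/
def matB (D : KCFData k l) : Matrix D.RowIdx D.ColIdx ℂ :=
  fromBlocks
    (fromBlocks 1 0 0 (blockDiagonal' fun b => jordanBlock (D.infSize b) 0)) 0 0
    (fromBlocks (blockDiagonal' fun i => LB (D.rightIdx i)) 0 0
      (blockDiagonal' fun i => (LB (D.leftIdx i))ᵀ))

end KCFData

/-- `A - lam B` has the Kronecker canonical form with data `D`: there are nonsingular `P, Q` such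
that `P (A - lam B) Q` is the canonical pencil, up to an enumeration of its rows and columns. -/
def HasKCF {n m k l : ℕ} (A B : Matrix (Fin n) (Fin m) ℂ) (D : KCFData k l) : Prop :=
  ∃ (er : D.RowIdx ≃ Fin n) (ec : D.ColIdx ≃ Fin m)
    (P : Matrix (Fin n) (Fin n) ℂ) (Q : Matrix (Fin m) (Fin m) ℂ),
    IsUnit P.det ∧ IsUnit Q.det ∧
    P * A * Q = reindex er ec D.matA ∧ P * B * Q = reindex er ec D.matB

/-- The pencil `A - lam B` has right minimal indices `mr` and left minimal indices `nl`
(each listed with repetitions, in some order). -/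
def HasMinimalIndices {n m k l : ℕ} (A B : Matrix (Fin n) (Fin m) ℂ)
    (mr : Fin k → ℕ) (nl : Fin l → ℕ) : Prop :=
  ∃ D : KCFData k l, D.rightIdx = mr ∧ D.leftIdx = nl ∧ HasKCF A B D

/-! ### Genericity -/

/-- The set of common zeros of finitely many complex polynomials. -/
def IsAlgebraicSet {σ : Type*} (S : Set (σ → ℂ)) : Prop :=
  ∃ F : Finset (MvPolynomial σ ℂ), S = {x | ∀ p ∈ F, MvPolynomial.eval x p = 0}

/-- A set is generic if its complement is contained in a proper algebraic set. -/
def IsGenericSet {σ : Type*} (Ω : Set (σ → ℂ)) : Prop :=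
  ∃ S : Set (σ → ℂ), IsAlgebraicSet S ∧ S ≠ Set.univ ∧ Ωᶜ ⊆ S

/-- The point of `ℂ^(2nk)` formed by the entries of `U` and of `V^*`. -/
def entries {n k : ℕ} (U V : Matrix (Fin n) (Fin k) ℂ) :
    (Fin n × Fin k) ⊕ (Fin k × Fin n) → ℂ :=
  Sum.elim (fun a => U a.1 a.2) (fun a => Vᴴ a.1 a.2)

/-- `Pr U V` holds generically with respect to the entries of `U` and `V^*`. -/
def Generically {n k : ℕ}
    (Pr : Matrix (Fin n) (Fin k) ℂ → Matrix (Fin n) (Fin k) ℂ → Prop) : Prop :=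
  ∃ Ω : Set ((Fin n × Fin k) ⊕ (Fin k × Fin n) → ℂ), IsGenericSet Ω ∧
    ∀ U V : Matrix (Fin n) (Fin k) ℂ, entries U V ∈ Ω → Pr U V

/-! ### Values with constrained null vectors -/

/-- There is `z ≠ 0` with `(A - a B) z = 0` and `V^* z = 0`. -/
def HasRightNullVector {n k : ℕ} (A B : Matrix (Fin n) (Fin n) ℂ)
    (V : Matrix (Fin n) (Fin k) ℂ) (a : ℂ) : Prop :=
  ∃ z : Fin n → ℂ, z ≠ 0 ∧ (A - a • B) *ᵥ z = 0 ∧ Vᴴ *ᵥ z = 0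

/-- There is `w ≠ 0` with `w^* (A - b B) = 0` and `w^* U = 0`. -/
def HasLeftNullVector {n k : ℕ} (A B : Matrix (Fin n) (Fin n) ℂ)
    (U : Matrix (Fin n) (Fin k) ℂ) (b : ℂ) : Prop :=
  ∃ w : Fin n → ℂ, w ≠ 0 ∧ star w ᵥ* (A - b • B) = 0 ∧ star w ᵥ* U = 0

end

end MatrixPencil

namespace MatrixPencil

open Polynomial

/-! Each block `L_{m_i}` yields a chain of vectors, hence a polynomial null vector `r_i(a) = ∑ b, a
^ b • v i b`. The `r_i(a)` are independent for every `a` and, by a dimension count, span the kernel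
of `A - a B` when `a` is not an eigenvalue. With `R(a)` the matrix of columns `r_i(a)`, the values
`α` are therefore the non-eigenvalue roots of `f(a) = det (V^* R(a))`, of degree at most `M`. The
transposed pencil and `Uᵀ` give `f'` of degree at most `N` for the `β`.

Let `E` consist of the eigenvalues and the `γ_i`. Statements 1 and 2 follow once `f`, `f'` have full
degree and `f f' ∏ (X - e)`, `e ∈ E`, is separable: this gives simple roots, disjointness and
avoidance of `E` together. Statement 3 follows from `f(γ_i) ≠ 0`, which makes `V^* R(γ_i)`
invertible.

The condition is open, cut out by a leading coefficient times a resultant with the derivative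
(`exists_eval_ne_zero_imp_separable`). It is attained because independence of the chains lets `V^*
R` and `Uᵀ R'` be diagonal with freely chosen entries (`exists_chainDet_eq_prod`,
`exists_separable_families`). -/

/-- Families of vectors `v i 0, …, v i (m i)`, jointly linearly independent, with
`A v i 0 = 0`, `A v i (b + 1) = B v i b` and `B v i (m i) = 0`. -/
structure IsKroneckerChain {n k : ℕ} (A B : Matrix (Fin n) (Fin n) ℂ) (m : Fin k → ℕ)
    (v : ((i : Fin k) × Fin (m i + 1)) → Fin n → ℂ) : Prop where
  indep : LinearIndependent ℂ v
  first : ∀ i, A *ᵥ v ⟨i, 0⟩ = 0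
  step : ∀ i (b : Fin (m i)), A *ᵥ v ⟨i, b.succ⟩ = B *ᵥ v ⟨i, b.castSucc⟩
  last : ∀ i, B *ᵥ v ⟨i, Fin.last _⟩ = 0

/-! ### Chains read off the Kronecker canonical form -/

theorem exists_isKroneckerChain_of_equiv {n k : ℕ} {A B P Q A' B' : Matrix (Fin n) (Fin n) ℂ}
    (hP : IsUnit P.det) (hQ : IsUnit Q.det) (hA : P * A * Q = A') (hB : P * B * Q = B')
    (m : Fin k → ℕ) (g : ((i : Fin k) × Fin (m i + 1)) → Fin n) (hg : Function.Injective g)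
    (h0 : ∀ i r, A' r (g ⟨i, 0⟩) = 0)
    (h1 : ∀ i (b : Fin (m i)) r, A' r (g ⟨i, b.succ⟩) = B' r (g ⟨i, b.castSucc⟩))
    (h2 : ∀ i r, B' r (g ⟨i, Fin.last _⟩) = 0) :
    ∃ v, IsKroneckerChain A B m v := by
  have hPi : Function.Injective P.mulVec := mulVec_injective_iff_isUnit.2
    ((isUnit_iff_isUnit_det _).2 hP)
  have hQi : Function.Injective Q.mulVec := mulVec_injective_iff_isUnit.2
    ((isUnit_iff_isUnit_det _).2 hQ)
  have key (C : Matrix (Fin n) (Fin n) ℂ) (s) :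
      P *ᵥ (C *ᵥ (Q *ᵥ Pi.single s 1)) = (P * C * Q).col s := by
    rw [mulVec_mulVec, mulVec_mulVec, mulVec_single_one, Matrix.mul_assoc]
  refine ⟨fun s => Q *ᵥ Pi.single (g s) 1, ?_, fun i => hPi ?_, fun i b => hPi ?_,
    fun i => hPi ?_⟩
  · have : LinearIndependent ℂ fun s => Pi.single (M := fun _ : Fin n => ℂ) (g s) (1 : ℂ) :=
      by simpa [Function.comp_def] using (Pi.basisFun ℂ (Fin n)).linearIndependent.comp g hg
    exact this.map' Q.mulVecLin (LinearMap.ker_eq_bot.2 hQi)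
  · rw [key, hA, mulVec_zero]; ext r; exact h0 i r
  · rw [key, hA, key, hB]; ext r; exact h1 i b r
  · rw [key, hB, mulVec_zero]; ext r; exact h2 i r

theorem HasKCF.exists_right_chain {n k l : ℕ} {A B : Matrix (Fin n) (Fin n) ℂ} {D : KCFData k l}
    (h : HasKCF A B D) : ∃ v, IsKroneckerChain A B D.rightIdx v := by
  obtain ⟨er, ec, P, Q, hP, hQ, hA, hB⟩ := h
  refine exists_isKroneckerChain_of_equiv hP hQ hA hB _ (fun s => ec (.inr (.inl s)))
    (ec.injective.comp (Sum.inr_injective.comp Sum.inl_injective)) ?_ ?_ ?_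
  · intro i r
    obtain ⟨ρ, rfl⟩ := er.surjective r
    rcases ρ with ρ | ⟨j, b⟩ | ρ <;> simp [KCFData.matA, blockDiagonal'_apply, LA]
    rintro rfl h; exact absurd h (Fin.succ_ne_zero _).symm
  · intro i b r
    obtain ⟨ρ, rfl⟩ := er.surjective r
    rcases ρ with ρ | ⟨j, c⟩ | ρ <;>
      simp [KCFData.matA, KCFData.matB, blockDiagonal'_apply, LA, LB]
    congr 1
    ext rfl
    simp
  · intro i r
    obtain ⟨ρ, rfl⟩ := er.surjective r
    rcases ρ with ρ | ⟨j, b⟩ | ρ <;> simp [KCFData.matB, blockDiagonal'_apply, LB]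
    rintro rfl h; exact absurd h (Fin.castSucc_lt_last _).ne'

theorem HasKCF.exists_left_chain {n k l : ℕ} {A B : Matrix (Fin n) (Fin n) ℂ} {D : KCFData k l}
    (h : HasKCF A B D) : ∃ v, IsKroneckerChain Aᵀ Bᵀ D.leftIdx v := by
  obtain ⟨er, ec, P, Q, hP, hQ, hA, hB⟩ := h
  -- Transposition swaps `P` and `Q` and turns the blocks `L_jᵀ` into `L_j`.
  have hA' : Qᵀ * Aᵀ * Pᵀ = (reindex er ec D.matA)ᵀ := by
    rw [← hA]; simp [Matrix.mul_assoc]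
  have hB' : Qᵀ * Bᵀ * Pᵀ = (reindex er ec D.matB)ᵀ := by
    rw [← hB]; simp [Matrix.mul_assoc]
  refine exists_isKroneckerChain_of_equiv (by rwa [det_transpose]) (by rwa [det_transpose])
    hA' hB' _ (fun s => er (.inr (.inr s)))
    (er.injective.comp (Sum.inr_injective.comp Sum.inr_injective)) ?_ ?_ ?_
  · intro i r
    obtain ⟨ρ, rfl⟩ := ec.surjective r
    rcases ρ with ρ | ρ | ⟨j, b⟩ <;> simp [KCFData.matA, blockDiagonal'_apply, LA]
    rintro rfl h; exact absurd h (Fin.succ_ne_zero _).symm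
  · intro i b r
    obtain ⟨ρ, rfl⟩ := ec.surjective r
    rcases ρ with ρ | ρ | ⟨j, c⟩ <;>
      simp [KCFData.matA, KCFData.matB, blockDiagonal'_apply, LA, LB]
  · intro i r
    obtain ⟨ρ, rfl⟩ := ec.surjective r
    rcases ρ with ρ | ρ | ⟨j, b⟩ <;> simp [KCFData.matB, blockDiagonal'_apply, LB]
    rintro rfl h; exact absurd h (Fin.castSucc_lt_last _).ne'

/-! ### Polynomial null vectors -/

/-- The polynomial curve `∑ b, a ^ b • v i b`. -/
def chainCurve {n k : ℕ} {m : Fin k → ℕ} (v : ((i : Fin k) × Fin (m i + 1)) → Fin n → ℂ)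
    (a : ℂ) (i : Fin k) : Fin n → ℂ :=
  ∑ b : Fin (m i + 1), a ^ (b : ℕ) • v ⟨i, b⟩

namespace IsKroneckerChain

variable {n k : ℕ} {A B : Matrix (Fin n) (Fin n) ℂ} {m : Fin k → ℕ}
  {v : ((i : Fin k) × Fin (m i + 1)) → Fin n → ℂ}

theorem mulVec_chainCurve (h : IsKroneckerChain A B m v) (a : ℂ) (i : Fin k) :
    (A - a • B) *ᵥ chainCurve v a i = 0 := by
  have hA : A *ᵥ chainCurve v a i
      = ∑ b : Fin (m i), a ^ (b + 1 : ℕ) • (B *ᵥ v ⟨i, b.castSucc⟩) := by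
    simp only [chainCurve, mulVec_sum, mulVec_smul]
    rw [Fin.sum_univ_succ, h.first]
    simp [h.step]
  have hB : B *ᵥ chainCurve v a i
      = ∑ b : Fin (m i), a ^ (b : ℕ) • (B *ᵥ v ⟨i, b.castSucc⟩) := by
    simp only [chainCurve, mulVec_sum, mulVec_smul]
    rw [Fin.sum_univ_castSucc, h.last]
    simp
  rw [sub_mulVec, smul_mulVec, hA, hB, Finset.smul_sum, sub_eq_zero]
  exact Finset.sum_congr rfl fun b _ => by rw [smul_smul, pow_succ']

/-- Extends a map defined on the span of the independent chain vectors; this freedom supplies the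
witness for genericity. -/
theorem exists_mulVec_eq (h : IsKroneckerChain A B m v)
    (τ : ((i : Fin k) × Fin (m i + 1)) → Fin k → ℂ) :
    ∃ W : Matrix (Fin k) (Fin n) ℂ, ∀ s, W *ᵥ v s = τ s := by
  obtain ⟨f, hf⟩ := LinearMap.exists_extend ((Module.Basis.span h.indep).constr ℂ τ)
  refine ⟨LinearMap.toMatrix' f, fun s => ?_⟩
  rw [LinearMap.toMatrix'_mulVec]
  have := LinearMap.congr_fun hf (Module.Basis.span h.indep s)
  rwa [LinearMap.comp_apply, Module.Basis.constr_basis, Submodule.subtype_apply,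
    Module.Basis.span_apply] at this

/-- A matrix sending `v i 0` to the `i`-th unit vector and every other chain vector to zero maps the
curves to the standard basis, whatever `a` is. -/
theorem linearIndependent_chainCurve (h : IsKroneckerChain A B m v) (a : ℂ) :
    LinearIndependent ℂ (chainCurve v a) := by
  obtain ⟨W, hW⟩ := h.exists_mulVec_eq fun s => if s.2 = 0 then Pi.single s.1 1 else 0
  refine LinearIndependent.of_comp W.mulVecLin ?_
  have : W.mulVecLin ∘ chainCurve v a = Pi.basisFun ℂ (Fin k) := by
    ext1 i
    rw [Function.comp_apply, mulVecLin_apply, chainCurve, mulVec_sum, Fin.sum_univ_succ]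
    simp [mulVec_smul, hW]
  rw [this]
  exact (Pi.basisFun ℂ (Fin k)).linearIndependent

end IsKroneckerChain

/-! ### Normal rank and eigenvalues -/

theorem rank_le_nrank {n m : ℕ} (A B : Matrix (Fin n) (Fin m) ℂ) (a : ℂ) :
    (A - a • B).rank ≤ nrank A B :=
  le_ciSup (f := fun z : ℂ => (A - z • B).rank)
    ⟨m, by rintro _ ⟨z, rfl⟩; exact rank_le_width _⟩ a

theorem exists_rank_eq_nrank {n m : ℕ} (A B : Matrix (Fin n) (Fin m) ℂ) :
    ∃ a : ℂ, (A - a • B).rank = nrank A B :=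
  Nat.sSup_mem (s := Set.range fun z : ℂ => (A - z • B).rank) (Set.range_nonempty _)
    ⟨m, by rintro _ ⟨z, rfl⟩; exact rank_le_width _⟩

theorem rank_transpose_sub {n m : ℕ} (A B : Matrix (Fin n) (Fin m) ℂ) (a : ℂ) :
    (Aᵀ - a • Bᵀ).rank = (A - a • B).rank := by
  rw [← rank_transpose (A - a • B), transpose_sub, transpose_smul]

theorem nrank_transpose {n m : ℕ} (A B : Matrix (Fin n) (Fin m) ℂ) :
    nrank Aᵀ Bᵀ = nrank A B := by
  simp only [nrank, rank_transpose_sub]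

theorem isEigenvalue_transpose {n m : ℕ} {A B : Matrix (Fin n) (Fin m) ℂ} {a : ℂ} :
    IsEigenvalue Aᵀ Bᵀ a ↔ IsEigenvalue A B a := by
  simp only [IsEigenvalue, nrank_transpose, rank_transpose_sub]

/-- After the equivalence that normalizes `A - z B` at a point `z` of maximal rank, the leading
block has a determinant polynomial in `a` that equals 1 at `z`; every eigenvalue is a root of it. -/
theorem finite_isEigenvalue {n : ℕ} (A B : Matrix (Fin n) (Fin n) ℂ) :
    {a | IsEigenvalue A B a}.Finite := by
  obtain ⟨z, hz⟩ := exists_rank_eq_nrank A B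
  obtain ⟨P, Q, e, -, -, hPQ⟩ := exists_rank_normal_form (A - z • B)
  let S (M : Matrix (Fin n) (Fin n) ℂ) : Matrix (Fin (A - z • B).rank) (Fin (A - z • B).rank) ℂ :=
    (P * M * Q).submatrix (fun i => e.symm (.inl i)) (fun i => e.symm (.inl i))
  let p : ℂ[X] := ((S A).map (C : ℂ →+* ℂ[X]) - (X : ℂ[X]) • (S B).map (C : ℂ →+* ℂ[X])).det
  have hp (a : ℂ) : p.eval a = (S (A - a • B)).det := by
    rw [← coe_evalRingHom, RingHom.map_det (evalRingHom a)]
    congr 1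
    ext i j
    simp [S, Matrix.mul_sub, Matrix.sub_mul, mul_comm a]
  have hp0 : p ≠ 0 := by
    intro h0
    have h1 : S (A - z • B) = 1 := by
      ext i j
      simp [S, hPQ, fromBlocks_apply₁₁]
    have := hp z
    rw [h0, h1] at this
    simp at this
  refine (p.roots.toFinset.finite_toSet).subset fun a ha => ?_
  simp only [Finset.mem_coe, Multiset.mem_toFinset, mem_roots hp0, IsRoot, hp]
  by_contra hne
  refine not_le.2 (show (A - a • B).rank < nrank A B from ha) ?_
  calc nrank A B = (S (A - a • B)).rank := by
        rw [rank_of_det_ne_zero hne, Fintype.card_fin, hz]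
    _ ≤ (P * (A - a • B) * Q).rank := rank_submatrix_le _ _ _
    _ ≤ (P * (A - a • B)).rank := rank_mul_le_left _ _
    _ ≤ _ := rank_mul_le_right _ _

theorem IsKroneckerChain.exists_eq_sum_chainCurve {n k : ℕ} {A B : Matrix (Fin n) (Fin n) ℂ}
    {m : Fin k → ℕ} {v : ((i : Fin k) × Fin (m i + 1)) → Fin n → ℂ}
    (h : IsKroneckerChain A B m v) (hr : nrank A B + k = n) {a : ℂ}
    (ha : ¬ IsEigenvalue A B a) {z : Fin n → ℂ} (hz : (A - a • B) *ᵥ z = 0) :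
    ∃ c : Fin k → ℂ, z = ∑ i, c i • chainCurve v a i := by
  have hrank : (A - a • B).rank = nrank A B := le_antisymm (rank_le_nrank A B a) (not_lt.1 ha)
  have hker := (A - a • B).mulVecLin.finrank_range_add_finrank_ker
  have hspan : Submodule.span ℂ (Set.range (chainCurve v a)) = (A - a • B).mulVecLin.ker := by
    refine Submodule.eq_of_le_of_finrank_eq ?_ ?_
    · rw [Submodule.span_le]
      rintro _ ⟨i, rfl⟩
      exact h.mulVec_chainCurve a i
    · rw [finrank_span_eq_card (h.linearIndependent_chainCurve a), Fintype.card_fin]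
      rw [Module.finrank_fin_fun] at hker
      change (A - a • B).rank + _ = n at hker
      omega
  have : z ∈ Submodule.span ℂ (Set.range (chainCurve v a)) := by
    rw [hspan]; exact hz
  obtain ⟨c, hc⟩ := (Submodule.mem_span_range_iff_exists_fun ℂ).1 this
  exact ⟨c, hc.symm⟩

/-! ### The determinant whose roots are the sought values -/

/-- The determinant of the polynomial matrix with entries `∑ b, Y j ⟨i, b⟩ X ^ b`. -/
noncomputable def chainDet {R : Type*} [CommRing R] {k : ℕ} {m : Fin k → ℕ}
    (Y : Fin k → ((i : Fin k) × Fin (m i + 1)) → R) : R[X] :=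
  (Matrix.of fun j i => ∑ b : Fin (m i + 1), monomial (b : ℕ) (Y j ⟨i, b⟩)).det

section chainDet

variable {R S : Type*} [CommRing R] [CommRing S] {k : ℕ} {m : Fin k → ℕ}

theorem chainDet_map (f : R →+* S) (Y : Fin k → ((i : Fin k) × Fin (m i + 1)) → R) :
    (chainDet Y).map f = chainDet fun j s => f (Y j s) := by
  rw [chainDet, ← coe_mapRingHom, RingHom.map_det (mapRingHom f), chainDet]
  congr 1
  ext1 j i
  simp [Polynomial.map_sum]

theorem natDegree_chainDet_le (Y : Fin k → ((i : Fin k) × Fin (m i + 1)) → R) :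
    (chainDet Y).natDegree ≤ ∑ i, m i := by
  rw [chainDet, det_apply]
  refine natDegree_sum_le_of_forall_le _ _ fun σ _ => (natDegree_smul_le _ _).trans ?_
  refine (natDegree_prod_le _ _).trans (Finset.sum_le_sum fun i _ => ?_)
  rw [of_apply]
  refine natDegree_sum_le_of_forall_le _ _ fun b _ => ?_
  exact (natDegree_monomial_le _).trans (Nat.lt_succ_iff.1 b.2)

theorem eval_chainDet {n : ℕ} (W : Matrix (Fin k) (Fin n) ℂ)
    (v : ((i : Fin k) × Fin (m i + 1)) → Fin n → ℂ) (a : ℂ) :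
    (chainDet fun j s => (W *ᵥ v s) j).eval a
      = (W * (Matrix.of fun l i => chainCurve v a i l)).det := by
  rw [chainDet, ← coe_evalRingHom, RingHom.map_det (evalRingHom a)]
  congr 1
  ext j i
  have : (W * (Matrix.of fun l i => chainCurve v a i l)) j i = (W *ᵥ chainCurve v a i) j := rfl
  rw [this]
  simp [chainCurve, mulVec_sum, mulVec_smul, eval_finsetSum, mul_comm]

theorem chainDet_single (c : Fin k → R[X]) (hc : ∀ i, (c i).natDegree ≤ m i) :
    (chainDet (m := m) fun j s => Pi.single (M := fun _ => R) s.1 ((c s.1).coeff s.2) j)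
      = ∏ i, c i := by
  rw [← det_diagonal, chainDet]
  congr 1
  ext1 j i
  rcases eq_or_ne j i with rfl | hji
  · simp only [of_apply, Pi.single_eq_same, diagonal_apply_eq]
    rw [Fin.sum_univ_eq_sum_range (fun b => monomial b ((c j).coeff b))]
    exact ((c j).as_sum_range' _ (Nat.lt_succ_iff.2 (hc j))).symm
  · simp [hji]

end chainDet

namespace IsKroneckerChain

variable {n k : ℕ} {A B : Matrix (Fin n) (Fin n) ℂ} {m : Fin k → ℕ}
  {v : ((i : Fin k) × Fin (m i + 1)) → Fin n → ℂ}

/-- Off the eigenvalues a null vector is `R(a) c` with `c` unique, so `W z = 0` becomes singularity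
of the `k × k` matrix `W R(a)`. -/
theorem exists_null_vector_iff (h : IsKroneckerChain A B m v) (hr : nrank A B + k = n)
    (W : Matrix (Fin k) (Fin n) ℂ) {a : ℂ} (ha : ¬ IsEigenvalue A B a) :
    (∃ z : Fin n → ℂ, z ≠ 0 ∧ (A - a • B) *ᵥ z = 0 ∧ W *ᵥ z = 0) ↔
      (chainDet fun j s => (W *ᵥ v s) j).eval a = 0 := by
  have hmul (c : Fin k → ℂ) :
      (Matrix.of fun l i => chainCurve v a i l) *ᵥ c = ∑ i, c i • chainCurve v a i := by
    ext l
    simp [mulVec, dotProduct, mul_comm]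
  rw [eval_chainDet, ← exists_mulVec_eq_zero_iff]
  constructor
  · rintro ⟨z, hz0, hz, hW⟩
    obtain ⟨c, rfl⟩ := h.exists_eq_sum_chainCurve hr ha hz
    refine ⟨c, ?_, by rw [← mulVec_mulVec, hmul, hW]⟩
    rintro rfl
    simp at hz0
  · rintro ⟨c, hc0, hc⟩
    refine ⟨∑ i, c i • chainCurve v a i, fun h0 => hc0 ?_, ?_, ?_⟩
    · exact funext (Fintype.linearIndependent_iff.1 (h.linearIndependent_chainCurve a) c h0)
    · simp [mulVec_sum, mulVec_smul, h.mulVec_chainCurve]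
    · rw [← hmul, mulVec_mulVec, hc]

theorem exists_mulVec_eq_of_eval_ne_zero (h : IsKroneckerChain A B m v)
    (W : Matrix (Fin k) (Fin n) ℂ) {a : ℂ}
    (ha : (chainDet fun j s => (W *ᵥ v s) j).eval a ≠ 0) (t : Fin k → ℂ) :
    ∃ s : Fin n → ℂ, (A - a • B) *ᵥ s = 0 ∧ W *ᵥ s = t := by
  rw [eval_chainDet] at ha
  set R : Matrix (Fin n) (Fin k) ℂ := Matrix.of fun l i => chainCurve v a i l
  have hAR : (A - a • B) * R = 0 := by
    ext j i
    exact congrFun (h.mulVec_chainCurve a i) j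
  -- Solve `(W R) c = t` and take `R c`.
  refine ⟨R *ᵥ ((W * R)⁻¹ *ᵥ t), ?_, ?_⟩
  · rw [mulVec_mulVec, hAR, zero_mulVec]
  · rw [mulVec_mulVec, mulVec_mulVec, mul_nonsing_inv _ (isUnit_iff_ne_zero.2 ha), one_mulVec]

theorem exists_chainDet_eq_prod (h : IsKroneckerChain A B m v) (c : Fin k → ℂ[X])
    (hc : ∀ i, (c i).natDegree ≤ m i) :
    ∃ W : Matrix (Fin k) (Fin n) ℂ, chainDet (fun j s => (W *ᵥ v s) j) = ∏ i, c i := by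
  obtain ⟨W, hW⟩ := h.exists_mulVec_eq fun s => Pi.single s.1 ((c s.1).coeff s.2)
  exact ⟨W, by simp only [hW]; exact chainDet_single c hc⟩

end IsKroneckerChain

/-! ### Genericity -/

/-- Having full degree and being separable is an open condition on the coefficients. -/
theorem exists_eval_ne_zero_imp_separable {σ : Type*} (F : (MvPolynomial σ ℂ)[X]) {d : ℕ}
    (hd : F.natDegree ≤ d) {x₀ : σ → ℂ} (h₀ : (F.map (MvPolynomial.eval x₀)).natDegree = d)
    (hs : (F.map (MvPolynomial.eval x₀)).Separable) :
    ∃ p : MvPolynomial σ ℂ, MvPolynomial.eval x₀ p ≠ 0 ∧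
      ∀ x, MvPolynomial.eval x p ≠ 0 → (F.map (MvPolynomial.eval x)).natDegree = d ∧
        (F.map (MvPolynomial.eval x)).Separable := by
  -- Fixing the formal degrees `d` and `d - 1` makes the resultant commute with specialization, even
  -- where the degree drops.
  have hres (x : σ → ℂ) : MvPolynomial.eval x (F.coeff d * resultant F F.derivative d (d - 1))
      = (F.map (MvPolynomial.eval x)).coeff d *
        resultant (F.map (MvPolynomial.eval x)) (F.map (MvPolynomial.eval x)).derivative
          d (d - 1) := by
    rw [map_mul, coeff_map, derivative_map, resultant_map_map]
  refine ⟨F.coeff d * resultant F F.derivative d (d - 1), ?_, fun x hx => ?_⟩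
  · rw [hres]
    set f := F.map (MvPolynomial.eval x₀)
    subst h₀
    refine mul_ne_zero ?_ ?_
    · exact leadingCoeff_ne_zero.2 hs.ne_zero
    · have := resultant_ne_zero f f.derivative hs
      rwa [natDegree_derivative] at this
  · rw [hres] at hx
    set f := F.map (MvPolynomial.eval x)
    have hf : f.natDegree = d :=
      le_antisymm (natDegree_map_le.trans hd) (le_natDegree_of_ne_zero (left_ne_zero_of_mul hx))
    refine ⟨hf, ?_⟩
    -- The Bézout identity for the resultant needs a positive formal degree; for `d = 0` the
    -- polynomial is a nonzero constant.
    rcases Nat.eq_zero_or_pos d with rfl | hpos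
    · rw [eq_C_of_natDegree_eq_zero hf, separable_C]
      exact isUnit_iff_ne_zero.2 (left_ne_zero_of_mul hx)
    · obtain ⟨p, q, -, -, hpq⟩ := exists_mul_add_mul_eq_C_resultant (m := d) (n := d - 1)
        f f.derivative hf.le ((natDegree_derivative_le f).trans (by rw [hf])) (.inl hpos.ne')
      have hr := right_ne_zero_of_mul hx
      set r := resultant f f.derivative d (d - 1)
      refine ⟨C r⁻¹ * p, C r⁻¹ * q, ?_⟩
      calc C r⁻¹ * p * f + C r⁻¹ * q * f.derivative
          = C r⁻¹ * (f * p + f.derivative * q) := by ring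
        _ = 1 := by rw [hpq, ← C_mul, inv_mul_cancel₀ hr, C_1]

/-- A separable complex polynomial of degree `d` has exactly `d` distinct roots. -/
theorem exists_injective_roots {p : ℂ[X]} {d : ℕ} (hd : p.natDegree = d) (hs : p.Separable) :
    ∃ α : Fin d → ℂ, Function.Injective α ∧ ∀ a, p.eval a = 0 ↔ ∃ i, a = α i := by
  have hcard : p.roots.toFinset.card = d := by
    rw [Multiset.toFinset_card_of_nodup (nodup_roots hs), ← hd,
      (IsAlgClosed.splits p).natDegree_eq_card_roots]
  let e := (p.roots.toFinset.equivFinOfCardEq hcard).symm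
  refine ⟨fun i => e i, Subtype.val_injective.comp e.injective, fun a => ?_⟩
  have ha : p.eval a = 0 ↔ a ∈ p.roots.toFinset := by simp [hs.ne_zero]
  rw [ha]
  constructor
  · intro h
    exact ⟨e.symm ⟨a, h⟩, by simp⟩
  · rintro ⟨i, rfl⟩
    exact (e i).2

/-- Two families of polynomials with prescribed degrees whose joint product is separable and
has no root in a given finite set. -/
theorem exists_separable_families {k l : ℕ} (m : Fin k → ℕ) (n : Fin l → ℕ) (E : Finset ℂ) :
    ∃ (c : Fin k → ℂ[X]) (d : Fin l → ℂ[X]), (∀ i, (c i).natDegree = m i) ∧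
      (∀ i, (d i).natDegree = n i) ∧ (∀ i, (c i).Monic) ∧ (∀ i, (d i).Monic) ∧
      ((∏ i, c i) * (∏ i, d i) * ∏ e ∈ E, (X - C e)).Separable := by
  let ι := ((i : Fin k) × Fin (m i)) ⊕ ((i : Fin l) × Fin (n i))
  have : Infinite ((E : Set ℂ)ᶜ : Set ℂ) := E.finite_toSet.infinite_compl.to_subtype
  let f : ι ↪ ((E : Set ℂ)ᶜ : Set ℂ) :=
    (Fintype.equivFin ι).toEmbedding.trans (Fin.valEmbedding.trans (Infinite.natEmbedding _))
  refine ⟨fun i => ∏ b, (X - C (f (.inl ⟨i, b⟩) : ℂ)), fun i => ∏ b, (X - C (f (.inr ⟨i, b⟩) : ℂ)),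
    fun i => by simp, fun i => by simp, fun i => monic_prod_X_sub_C _ _,
    fun i => monic_prod_X_sub_C _ _, ?_⟩
  have hinj : Function.Injective (Sum.elim (fun s => (f s : ℂ)) (fun e : E => (e : ℂ))) := by
    refine Function.Injective.sumElim (Subtype.val_injective.comp f.injective)
      Subtype.val_injective fun s e he => (f s).2 ?_
    rw [he]; exact e.2
  have hsep := separable_prod_X_sub_C_iff.2 hinj
  rw [Fintype.prod_sum_type, Fintype.prod_sum_type, Fintype.prod_sigma, Fintype.prod_sigma] at hsep
  simpa only [Sum.elim_inl, Sum.elim_inr, Finset.prod_coe_sort E fun e => X - C e] using hsep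

/-- One polynomial controls both sides: `F` is the product with the entries of `U` and `V^*` as
indeterminates. Taking `V^*` itself as coordinates avoids complex conjugation. -/
theorem IsKroneckerChain.exists_generic {n k : ℕ} {A B A' B' : Matrix (Fin n) (Fin n) ℂ}
    {m m' : Fin k → ℕ} {v : ((i : Fin k) × Fin (m i + 1)) → Fin n → ℂ}
    {v' : ((i : Fin k) × Fin (m' i + 1)) → Fin n → ℂ} (h : IsKroneckerChain A B m v)
    (h' : IsKroneckerChain A' B' m' v') (E : Finset ℂ) :
    ∃ p : MvPolynomial ((Fin n × Fin k) ⊕ (Fin k × Fin n)) ℂ, p ≠ 0 ∧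
      ∀ U V : Matrix (Fin n) (Fin k) ℂ, MvPolynomial.eval (entries U V) p ≠ 0 →
        (chainDet fun j s => (Vᴴ *ᵥ v s) j).natDegree = ∑ i, m i ∧
        (chainDet fun j s => (Uᵀ *ᵥ v' s) j).natDegree = ∑ i, m' i ∧
        ((chainDet fun j s => (Vᴴ *ᵥ v s) j) * (chainDet fun j s => (Uᵀ *ᵥ v' s) j) *
          ∏ e ∈ E, (X - C e)).Separable := by
  let σ := (Fin n × Fin k) ⊕ (Fin k × Fin n)
  let Y (j : Fin k) (s : (i : Fin k) × Fin (m i + 1)) : MvPolynomial σ ℂ :=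
    ∑ l, MvPolynomial.X (.inr (j, l)) * MvPolynomial.C (v s l)
  let Y' (j : Fin k) (s : (i : Fin k) × Fin (m' i + 1)) : MvPolynomial σ ℂ :=
    ∑ l, MvPolynomial.X (.inl (l, j)) * MvPolynomial.C (v' s l)
  let F : (MvPolynomial σ ℂ)[X] :=
    chainDet Y * chainDet Y' * ∏ e ∈ E, (X - C (MvPolynomial.C e))
  have hF (U V : Matrix (Fin n) (Fin k) ℂ) : F.map (MvPolynomial.eval (entries U V)) =
      (chainDet fun j s => (Vᴴ *ᵥ v s) j) * (chainDet fun j s => (Uᵀ *ᵥ v' s) j) *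
          ∏ e ∈ E, (X - C e) := by
    simp [F, Y, Y', chainDet_map, Polynomial.map_prod, entries, mulVec, dotProduct]
  have hdeg : F.natDegree ≤ (∑ i, m i) + (∑ i, m' i) + E.card := by
    refine natDegree_mul_le_of_le (natDegree_mul_le_of_le (natDegree_chainDet_le _)
      (natDegree_chainDet_le _)) ?_
    rw [natDegree_finsetProd_X_sub_C_eq_card]
  obtain ⟨c, c', hc, hc', hcm, hcm', hsep⟩ := exists_separable_families m m' E
  obtain ⟨W, hW⟩ := h.exists_chainDet_eq_prod c fun i => (hc i).le
  obtain ⟨W', hW'⟩ := h'.exists_chainDet_eq_prod c' fun i => (hc' i).le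
  have h₀ : F.map (MvPolynomial.eval (entries W'ᵀ Wᴴ)) =
      (∏ i, c i) * (∏ i, c' i) * ∏ e ∈ E, (X - C e) := by
    rw [hF, conjTranspose_conjTranspose, transpose_transpose, hW, hW']
  have hE : (∏ e ∈ E, (X - C e) : ℂ[X]).Monic := monic_prod_X_sub_C _ _
  have hEd : (∏ e ∈ E, (X - C e) : ℂ[X]).natDegree = E.card :=
    natDegree_finsetProd_X_sub_C_eq_card _ _
  have hm := monic_prod_of_monic Finset.univ c fun i _ => hcm i
  have hm' := monic_prod_of_monic Finset.univ c' fun i _ => hcm' i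
  obtain ⟨p, hp, hpx⟩ := exists_eval_ne_zero_imp_separable F hdeg (x₀ := entries W'ᵀ Wᴴ)
    (by rw [h₀, (hm.mul hm').natDegree_mul hE, hm.natDegree_mul hm', hEd,
          natDegree_prod_of_monic _ _ fun i _ => hcm i,
          natDegree_prod_of_monic _ _ fun i _ => hcm' i]; simp [hc, hc'])
    (by rwa [h₀])
  refine ⟨p, fun h => hp (by simp [h]), fun U V hUV => ?_⟩
  obtain ⟨hd, hs⟩ := hpx _ hUV
  rw [hF] at hd hs
  have h1 := natDegree_chainDet_le (m := m) fun j s => (Vᴴ *ᵥ v s) j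
  -- The total degree attains the sum of the upper bounds, so each factor attains its own.
  have h2 := natDegree_chainDet_le (m := m') fun j s => (Uᵀ *ᵥ v' s) j
  have hne := left_ne_zero_of_mul hs.ne_zero
  rw [natDegree_mul hne hE.ne_zero, hEd,
    natDegree_mul (left_ne_zero_of_mul hne) (right_ne_zero_of_mul hne)] at hd
  exact ⟨by omega, by omega, hs⟩

theorem eval_ne_zero_of_separable_mul {p q : ℂ[X]} (h : (p * q).Separable) {a : ℂ}
    (ha : p.eval a = 0) : q.eval a ≠ 0 := by
  intro hq
  obtain ⟨r, s, hrs⟩ := h.isCoprime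
  simpa [ha, hq] using congrArg (Polynomial.eval a) hrs

theorem hasLeftNullVector_iff {n k : ℕ} {A B : Matrix (Fin n) (Fin n) ℂ}
    {U : Matrix (Fin n) (Fin k) ℂ} {b : ℂ} :
    HasLeftNullVector A B U b ↔
      ∃ z : Fin n → ℂ, z ≠ 0 ∧ (Aᵀ - b • Bᵀ) *ᵥ z = 0 ∧ Uᵀ *ᵥ z = 0 := by
  simp only [← transpose_smul, ← transpose_sub, mulVec_transpose]
  constructor
  · rintro ⟨w, hw, h1, h2⟩
    exact ⟨star w, star_ne_zero.2 hw, h1, h2⟩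
  · rintro ⟨z, hz, h1, h2⟩
    exact ⟨star z, star_ne_zero.2 hz, by rwa [star_star], by rwa [star_star]⟩

end MatrixPencil

/-! ### The main theorem -/

theorem mainTheorem4 (n k : ℕ) (A B : Matrix (Fin n) (Fin n) ℂ)
    (hsing : MatrixPencil.IsSingular A B)
    (hrank : MatrixPencil.nrank A B + k = n)
    (nl mr : Fin k → ℕ)
    (hidx : MatrixPencil.HasMinimalIndices A B mr nl)
    (γ : Fin k → ℂ) (hγ : ∀ i, ¬ MatrixPencil.IsEigenvalue A B (γ i)) :
    MatrixPencil.Generically fun U V : Matrix (Fin n) (Fin k) ℂ =>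
      U.rank = k → V.rank = k →
      -- the `M = ∑ mr i` values `α` and the `N = ∑ nl i` values `β`
      (∃ (α : Fin (∑ i, mr i) → ℂ) (β : Fin (∑ i, nl i) → ℂ),
        (Function.Injective α ∧
          (∀ i, ¬ MatrixPencil.IsEigenvalue A B (α i)) ∧
          (∀ i j, α i ≠ γ j) ∧
          (∀ a : ℂ, ¬ MatrixPencil.IsEigenvalue A B a →
            (MatrixPencil.HasRightNullVector A B V a ↔ ∃ i, a = α i))) ∧
        (Function.Injective β ∧
          (∀ i, ¬ MatrixPencil.IsEigenvalue A B (β i)) ∧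
          (∀ i j, β i ≠ γ j) ∧
          (∀ i j, β i ≠ α j) ∧
          (∀ b : ℂ, ¬ MatrixPencil.IsEigenvalue A B b →
            (MatrixPencil.HasLeftNullVector A B U b ↔ ∃ i, b = β i)))) ∧
      -- the vectors `s i` for the prescribed values `γ i`
      (∀ t : Fin k → (Fin k → ℂ), LinearIndependent ℂ t →
        ∃ s : Fin k → (Fin n → ℂ), ∀ i,
          s i ≠ 0 ∧ (A - γ i • B) *ᵥ s i = 0 ∧ t i = Vᴴ *ᵥ s i) := by
  classical
  obtain ⟨D, rfl, rfl, hD⟩ := hidx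
  obtain ⟨v, hv⟩ := hD.exists_right_chain
  obtain ⟨v', hv'⟩ := hD.exists_left_chain
  -- As a finite set, `E` lists repeated `γ i` only once, so the product over it can be separable.
  let E : Finset ℂ := (MatrixPencil.finite_isEigenvalue A B).toFinset ∪ Finset.univ.image γ
  have hEeig {a : ℂ} (ha : MatrixPencil.IsEigenvalue A B a) : a ∈ E :=
    Finset.mem_union_left _ (by simpa using ha)
  have hEγ (i : Fin k) : γ i ∈ E := Finset.mem_union_right _ (by simp)
  obtain ⟨p, hp0, hp⟩ := hv.exists_generic hv' E
  refine ⟨{x | MvPolynomial.eval x p ≠ 0}, ⟨{x | MvPolynomial.eval x p = 0}, ⟨{p}, by simp⟩,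
    fun h => hp0 (MvPolynomial.funext fun x => ?_), fun x hx => by simpa using hx⟩, ?_⟩
  · have : x ∈ {x | MvPolynomial.eval x p = 0} := h ▸ Set.mem_univ x
    simpa using this
  intro U V hUV _ _
  obtain ⟨hd, hd', hs⟩ := hp U V hUV
  set f := MatrixPencil.chainDet fun j s => (Vᴴ *ᵥ v s) j
  set f' := MatrixPencil.chainDet fun j s => (Uᵀ *ᵥ v' s) j
  have hE {e : ℂ} (he : e ∈ E) : (∏ e ∈ E, (Polynomial.X - Polynomial.C e)).eval e = 0 := by
    rw [Polynomial.eval_prod]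
    exact Finset.prod_eq_zero he (by simp)
  have hf {a : ℂ} (ha : f.eval a = 0) : a ∉ E := fun he =>
    MatrixPencil.eval_ne_zero_of_separable_mul hs (a := a) (by simp [ha]) (hE he)
  have hf' {a : ℂ} (ha : f'.eval a = 0) : a ∉ E := fun he =>
    MatrixPencil.eval_ne_zero_of_separable_mul hs (a := a) (by simp [ha]) (hE he)
  obtain ⟨α, hα, hαf⟩ := MatrixPencil.exists_injective_roots hd hs.of_mul_left.of_mul_left
  obtain ⟨β, hβ, hβf⟩ := MatrixPencil.exists_injective_roots hd' hs.of_mul_left.of_mul_right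
  have hα0 i : f.eval (α i) = 0 := (hαf _).2 ⟨i, rfl⟩
  have hβ0 i : f'.eval (β i) = 0 := (hβf _).2 ⟨i, rfl⟩
  refine ⟨⟨α, β, ⟨hα, fun i h => hf (hα0 i) (hEeig h), fun i j h => hf (hα0 i) (h ▸ hEγ j),
    fun a ha => (hv.exists_null_vector_iff hrank _ ha).trans (hαf a)⟩,
    hβ, fun i h => hf' (hβ0 i) (hEeig h), fun i j h => hf' (hβ0 i) (h ▸ hEγ j),
    fun i j h => MatrixPencil.eval_ne_zero_of_separable_mul hs.of_mul_left (hα0 j) (h ▸ hβ0 i),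
    fun b hb => ?_⟩, fun t ht => ?_⟩
  · rw [MatrixPencil.hasLeftNullVector_iff, ← hβf]
    exact hv'.exists_null_vector_iff (by rwa [MatrixPencil.nrank_transpose]) _
      (MatrixPencil.isEigenvalue_transpose.not.2 hb)
  · choose s hs1 hs2 using fun i => hv.exists_mulVec_eq_of_eval_ne_zero Vᴴ (a := γ i)
      (fun h => hf h (hEγ i)) (t i)
    refine ⟨s, fun i => ⟨fun h0 => ht.ne_zero i ?_, hs1 i, (hs2 i).symm⟩⟩
    rw [← hs2 i, h0, mulVec_zero]
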